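/- Let $f$ be analytic and univalent (injective) in the open unit disc $\mathbb{D}=\{z\in\mathbb{C}:|z|<1\}$ with $f(0)=0$ and $f'(0)=1$, i.e. $f(z)=z+a_2z^2+a_3z^3+\cdots$. Let $\gamma_1,\gamma_2,\ldots$ be its logarithmic coefficients, defined by $$\log\frac{f(z)}{z}=2\sum_{n=1}^{\infty}\gamma_n z^n,\qquad z\in\mathbb{D},$$ where $\log\frac{f(z)}{z}$ denotes the analytic branch in $\mathbb{D}$ that takes the value $0$ at $z=0$ (with $\frac{f(z)}{z}$ read as $1$ at $z=0$). Then $$|\gamma_3|-|\gamma_2|\le\frac{1}{\sqrt5}\qquad\text{and}\qquad|\gamma_4|-|\gamma_3|\le\frac{1}{\sqrt7}.$$ -/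

import Mathlib

/-- The class `S`: functions analytic and univalent (injective) in the open unit disc,
normalized by `f 0 = 0` and `f' 0 = 1`, that is `f z = z + a₂ z² + a₃ z³ + ⋯`. -/
structure IsClassS (f : ℂ → ℂ) : Prop where
  differentiableOn : DifferentiableOn ℂ f (Metric.ball 0 1)
  injOn : Set.InjOn f (Metric.ball 0 1)
  map_zero : f 0 = 0
  deriv_zero : deriv f 0 = 1

/-- `L` is the analytic branch of `log (f z / z)` in the open unit disc that vanishes at `0`. -/
structure IsLogBranch (f L : ℂ → ℂ) : Prop where
  differentiableOn : DifferentiableOn ℂ L (Metric.ball 0 1)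
  map_zero : L 0 = 0
  exp_eq : ∀ z ∈ Metric.ball (0 : ℂ) 1, z ≠ 0 → Complex.exp (L z) = f z / z

/-- `γ 1, γ 2, …` are the logarithmic coefficients of `f`:
`log (f z / z) = 2 ∑_{n ≥ 1} γ n z ^ n` in the open unit disc (the value `γ 0` is not used). -/
def IsLogCoeffs (f : ℂ → ℂ) (γ : ℕ → ℂ) : Prop :=
  ∃ L : ℂ → ℂ, IsLogBranch f L ∧
    ∀ z ∈ Metric.ball (0 : ℂ) 1, HasSum (fun n : ℕ => 2 * (γ (n + 1) * z ^ (n + 1))) (L z)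

/-- Every function of the class `S` has logarithmic coefficients. -/
theorem IsClassS.exists_isLogCoeffs {f : ℂ → ℂ} (hf : IsClassS f) :
    ∃ γ : ℕ → ℂ, IsLogCoeffs f γ := by
  have hmem : Metric.ball (0 : ℂ) 1 ∈ nhds (0 : ℂ) := Metric.ball_mem_nhds 0 one_pos
  have h0 : (0 : ℂ) ∈ Metric.ball (0 : ℂ) 1 := Metric.mem_ball_self one_pos
  set g := dslope f 0 with hg
  have hgd : DifferentiableOn ℂ g (Metric.ball 0 1) :=
    (Complex.differentiableOn_dslope hmem).2 hf.differentiableOn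
  have hg0 : g 0 = 1 := by rw [hg, dslope_same, hf.deriv_zero]
  have hgz : ∀ z, z ≠ 0 → g z = f z / z := fun z hz => by
    rw [hg, dslope_of_ne _ hz, slope_def_field, hf.map_zero, sub_zero, sub_zero]
  have hgne : ∀ z ∈ Metric.ball (0 : ℂ) 1, g z ≠ 0 := by
    intro z hz
    by_cases h : z = 0
    · rw [h, hg0]; exact one_ne_zero
    · rw [hgz z h]
      refine div_ne_zero (fun hfz => h (hf.injOn hz h0 ?_)) h
      rw [hfz, hf.map_zero]
  have hq : DifferentiableOn ℂ (fun z => deriv g z / g z) (Metric.ball 0 1) :=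
    (hgd.deriv Metric.isOpen_ball).div hgd hgne
  obtain ⟨L, hL0, hL⟩ := hq.isExactOn_ball.with_val_at 0 0
  have hLd : DifferentiableOn ℂ L (Metric.ball 0 1) := fun z hz =>
    (hL z hz).differentiableAt.differentiableWithinAt
  have hder : ∀ z ∈ Metric.ball (0 : ℂ) 1,
      HasDerivAt (fun w => g w * Complex.exp (-L w)) 0 z := by
    intro z hz
    have h1 := (hgd.differentiableAt (Metric.isOpen_ball.mem_nhds hz)).hasDerivAt
    have h2 := h1.mul ((hL z hz).neg.cexp)
    refine h2.congr_deriv ?_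
    have := hgne z hz
    simp only [Pi.neg_apply]
    field_simp
    ring
  have hconst : ∀ z ∈ Metric.ball (0 : ℂ) 1, g z * Complex.exp (-L z) = 1 := by
    intro z hz
    have := Metric.isOpen_ball.is_const_of_deriv_eq_zero
      (convex_ball (0 : ℂ) 1).isPreconnected
      (fun w hw => (hder w hw).differentiableAt.differentiableWithinAt)
      (fun w hw => (hder w hw).deriv) hz h0
    simpa [hL0, hg0] using this
  refine ⟨fun n => (n.factorial : ℂ)⁻¹ * iteratedDeriv n L 0 / 2, L, ⟨hLd, hL0, ?_⟩, ?_⟩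
  · intro z hz hz0
    rw [← hgz z hz0, ← mul_one (Complex.exp (L z)), ← hconst z hz, mul_left_comm, ← Complex.exp_add]
    simp
  · intro z hz
    have h := Complex.hasSum_taylorSeries_on_ball hLd hz
    rw [← hasSum_nat_add_iff' 1] at h
    have e : L z - ∑ i ∈ Finset.range 1,
        ((i.factorial : ℂ)⁻¹ • (z - 0) ^ i • iteratedDeriv i L 0) = L z := by
      simp [hL0]
    rw [e] at h
    have e' : (fun n : ℕ => 2 * (((n + 1).factorial : ℂ)⁻¹ * iteratedDeriv (n + 1) L 0 / 2
        * z ^ (n + 1))) = fun n : ℕ =>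
        ((n + 1).factorial : ℂ)⁻¹ • (z - 0) ^ (n + 1) • iteratedDeriv (n + 1) L 0 := by
      funext n
      rw [sub_zero, smul_eq_mul, smul_eq_mul]
      ring
    rw [← e'] at h
    exact h

/-!
The reciprocal of the square root transform of `f`, that is
`F z = 1 / √(f (z ^ 2)) = exp (-l (z ^ 2)) / z` with `l z = log (f z / z) / 2 = ∑ γ n * z ^ n`, is
univalent in the punctured unit disc with a simple pole at `0`. Hence Gronwall's area theorem
(`area_theorem`) bounds the coefficients `e n` of `exp (-l)`:
`‖e 1‖² + 3 ‖e 2‖² + 5 ‖e 3‖² + 7 ‖e 4‖² ≤ 1` (`sum_sq_norm_coeff_exp_le_one`). Expanding the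
exponential gives `e 1 = -γ 1`, `e 2 = -γ 2 + γ 1² / 2`, and
`γ 3 - γ 1 γ 2 = -(e 3 + γ 1³ / 6)`, `γ 4 - γ 1 γ 3 = -e 4 + e 2² / 2 - γ 1⁴ / 12`.
Since `‖γ 1‖ ≤ 1`, one has `‖γ (n + 1)‖ - ‖γ n‖ ≤ ‖γ (n + 1) - γ 1 γ n‖`, and what remains are two
elementary inequalities, which hold because `√(1 - q) ≤ 1 - q / 2` absorbs the extra terms.

For the area theorem, let `F z = G z / z = 1 / z + a 1 + a 2 z + ⋯`. The area of the image of the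
annulus `ρ < ‖z‖ < 1` is the integral of `‖F'‖²`, which polar coordinates and Bessel's inequality on
each circle bound below by `π (ρ⁻² - 1 + ∑ n ‖a (n + 1)‖² (1 - ρ^(2n)))`
(`le_volume_image_annulus`). On the circle `‖z‖ = ρ` the leading part `1 / z + a 1 + a 2 z` agrees
with the affine map `z ↦ conj z / ρ² + a 1 + a 2 z`, so `F` maps this circle into a solid ellipse of
area at most `π ρ⁻² (1 + O(ρ³))`. The image of the inside of the circle covers the connected
complement of this ellipse, so by injectivity the annulus is mapped into it
(`eventually_mapsTo_ellipse`). Comparing the two areas and letting `ρ → 0` gives the theorem.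
A disc in place of the ellipse would leave an error of order `‖a 2‖` which does not vanish.
-/

open Filter Topology Metric MeasureTheory

/-! ### Power series and Bessel's inequality -/

/-- The coefficients of a power series expansion on the unit disc are the Taylor coefficients. -/
theorem iteratedDeriv_zero_of_hasSum {a : ℕ → ℂ} {G : ℂ → ℂ}
    (ha : ∀ z ∈ ball (0 : ℂ) 1, HasSum (fun n => a n * z ^ n) (G z)) (n : ℕ) :
    iteratedDeriv n G 0 = n.factorial * a n := by
  have hp : HasFPowerSeriesAt G (FormalMultilinearSeries.ofScalars ℂ a) 0 := by
    rw [hasFPowerSeriesAt_iff]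
    filter_upwards [ball_mem_nhds (0 : ℂ) one_pos] with z hz
    simpa [mul_comm] using ha z hz
  have h := congrArg (fun p => p.coeff n)
    (hp.eq_formalMultilinearSeries hp.analyticAt.hasFPowerSeriesAt)
  simp only [FormalMultilinearSeries.coeff_ofScalars] at h
  rw [h, mul_div_cancel₀ _ (Nat.cast_ne_zero.2 n.factorial_ne_zero)]

/-- The coefficients of `z ↦ z * deriv G z - G z` are `(n - 1) * a n`. -/
theorem hasSum_mul_deriv_sub {a : ℕ → ℂ} {G : ℂ → ℂ} (hG : DifferentiableOn ℂ G (ball 0 1))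
    (ha : ∀ z ∈ ball (0 : ℂ) 1, HasSum (fun n => a n * z ^ n) (G z))
    {z : ℂ} (hz : z ∈ ball (0 : ℂ) 1) :
    HasSum (fun n : ℕ => ((n : ℂ) - 1) * a n * z ^ n) (z * deriv G z - G z) := by
  have h1 := (Complex.hasSum_taylorSeries_on_ball (hG.deriv isOpen_ball) hz).mul_left z
  have h2 : HasSum (fun n : ℕ => (n : ℂ) * a n * z ^ n) (z * deriv G z) := by
    rw [← hasSum_nat_add_iff' 1]
    simp only [Finset.range_one, Finset.sum_singleton, Nat.cast_zero, zero_mul, sub_zero]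
    convert! h1 using 2 with n
    rw [← iteratedDeriv_succ', iteratedDeriv_zero_of_hasSum ha (n + 1), Nat.factorial_succ]
    have := Nat.factorial_ne_zero n
    simp only [sub_zero, smul_eq_mul]
    push_cast
    field_simp
    ring
  convert! h2.sub (ha z hz) using 2 with n
  ring

/-- **Bessel's inequality** for a power series on the circle of radius `s`. -/
theorem sum_sq_norm_le_circleAverage {c : ℕ → ℂ} {f : ℂ → ℂ} {s : ℝ}
    (hf : ∀ z : ℂ, ‖z‖ = |s| → HasSum (fun n => c n * z ^ n) (f z)) (N : ℕ) :
    ∑ n ∈ Finset.range N, ‖c n‖ ^ 2 * s ^ (2 * n)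
      ≤ Real.circleAverage (fun z => ‖f z‖ ^ 2) 0 s := by
  have hsum : Summable fun n => ‖c n‖ * |s| ^ n := by
    have := (hf (s : ℂ) (by simp)).summable.norm
    simpa using this
  have hpoly : ∀ M : ℕ, Real.circleAverage (fun z => ‖∑ n ∈ Finset.range M, c n * z ^ n‖ ^ 2) 0 s
      = ∑ n ∈ Finset.range M, ‖c n‖ ^ 2 * s ^ (2 * n) := by
    intro M
    set p : Polynomial ℂ := ∑ n ∈ Finset.range M, Polynomial.C (c n * s ^ n) * Polynomial.X ^ n
      with hp
    have hcoeff : ∀ n, p.coeff n = if n ∈ Finset.range M then c n * s ^ n else 0 := by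
      intro n
      simp only [hp, Polynomial.finsetSum_coeff, Polynomial.coeff_C_mul_X_pow]
      rw [Finset.sum_ite_eq]
    have h := p.sum_sq_norm_coeff_eq_circleAverage
    have e1 : ∑ i ∈ p.support, ‖p.coeff i‖ ^ 2 = ∑ n ∈ Finset.range M, ‖p.coeff n‖ ^ 2 := by
      refine Finset.sum_subset ?_ ?_
      · intro n hn
        by_contra hnM
        exact Polynomial.mem_support_iff.1 hn (by rw [hcoeff, if_neg hnM])
      · intro n _ hn
        simp [Polynomial.notMem_support_iff.1 hn]
    have e2 : ∑ n ∈ Finset.range M, ‖p.coeff n‖ ^ 2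
        = ∑ n ∈ Finset.range M, ‖c n‖ ^ 2 * s ^ (2 * n) := by
      refine Finset.sum_congr rfl fun n hn => ?_
      rw [hcoeff, if_pos hn, norm_mul, mul_pow, norm_pow, Complex.norm_real, Real.norm_eq_abs,
        ← pow_mul, mul_comm n 2, pow_mul, sq_abs, ← pow_mul]
    rw [← e2, ← e1, h, Real.circleAverage, Real.circleAverage]
    congr 2
    ext θ
    simp only [hp, Polynomial.eval_finsetSum, Polynomial.eval_mul, Polynomial.eval_C,
      Polynomial.eval_pow, Polynomial.eval_X, circleMap_zero]
    congr 2
    refine Finset.sum_congr rfl fun n _ => ?_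
    push_cast
    ring
  have hlim : Tendsto
      (fun M => Real.circleAverage (fun z => ‖∑ n ∈ Finset.range M, c n * z ^ n‖ ^ 2) 0 s) atTop
      (𝓝 (Real.circleAverage (fun z => ‖f z‖ ^ 2) 0 s)) := by
    simp only [Real.circleAverage]
    refine Tendsto.const_smul ?_ _
    refine intervalIntegral.tendsto_integral_filter_of_dominated_convergence
      (fun _ => (∑' n, ‖c n‖ * |s| ^ n) ^ 2) ?_ ?_ ?_ ?_
    · refine Eventually.of_forall fun M => Continuous.aestronglyMeasurable ?_
      fun_prop
    · refine Eventually.of_forall fun M => Eventually.of_forall fun θ _ => ?_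
      rw [norm_pow, norm_norm]
      gcongr
      refine (norm_sum_le _ _).trans ?_
      have : ∀ n ∈ Finset.range M, ‖c n * circleMap 0 s θ ^ n‖ = ‖c n‖ * |s| ^ n := by
        intro n _
        simp
      rw [Finset.sum_congr rfl this]
      exact hsum.sum_le_tsum _ fun n _ => by positivity
    · exact intervalIntegrable_const
    · refine Eventually.of_forall fun θ _ => ?_
      exact ((hf _ (by simp)).tendsto_sum_nat.norm).pow 2
  refine ge_of_tendsto hlim ?_
  filter_upwards [eventually_ge_atTop N] with M hM
  rw [hpoly]
  refine Finset.sum_le_sum_of_subset_of_nonneg (Finset.range_subset_range.2 hM) fun n _ _ => ?_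
  rw [pow_mul]
  positivity

/-! ### Topology of a function with a pole -/

/-- The complement of a closed disc centred at `0` in the plane is connected. -/
theorem isPreconnected_setOf_lt_norm {R : ℝ} (hR : 0 ≤ R) :
    IsPreconnected {u : ℂ | R < ‖u‖} := by
  have h : {u : ℂ | R < ‖u‖} =
      (fun p : ℝ × ℝ => (p.1 : ℂ) * Complex.exp (p.2 * Complex.I)) '' Set.Ioi R ×ˢ Set.univ := by
    ext u
    constructor
    · intro hu
      exact ⟨(‖u‖, u.arg), ⟨hu, trivial⟩, Complex.norm_mul_exp_arg_mul_I u⟩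
    · rintro ⟨⟨r, θ⟩, ⟨hr, -⟩, rfl⟩
      have hr' : R < r := hr
      simpa [Complex.norm_exp_ofReal_mul_I, abs_of_pos (hR.trans_lt hr')] using hr'
  rw [h]
  refine (isPreconnected_Ioi.prod isPreconnected_univ).image _ ?_
  fun_prop

/-- Let `F` be univalent in the punctured disc with a pole at `0`. If `K` is a bounded set with
connected complement which contains the image of a circle, then `F` maps the points outside that
circle into `K`: the image of the inside covers the complement of `K`. -/
theorem mapsTo_of_mapsTo_sphere {F : ℂ → ℂ} {ρ : ℝ} (hρ : 0 < ρ) (hρ1 : ρ < 1)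
    (hF : DifferentiableOn ℂ F (ball 0 1 \ {0})) (hinj : Set.InjOn F (ball 0 1 \ {0}))
    (hlim : Tendsto F (𝓝[≠] 0) (Bornology.cobounded ℂ)) {K : Set ℂ} (hK : Bornology.IsBounded K)
    (hKc : IsPreconnected Kᶜ) (hsph : Set.MapsTo F (sphere 0 ρ) K) :
    Set.MapsTo F (ball 0 1 \ closedBall 0 ρ) K := by
  have hUo : IsOpen (ball (0 : ℂ) 1 \ {0}) := isOpen_ball.sdiff isClosed_singleton
  set S : Set ℂ := F '' (ball 0 ρ \ {0}) with hS
  set S' : Set ℂ := F '' (closedBall 0 ρ \ {0}) with hS'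
  have hsub : closedBall (0 : ℂ) ρ \ {0} ⊆ ball 0 1 \ {0} :=
    Set.sdiff_subset_sdiff_left (closedBall_subset_ball hρ1)
  have hSS' : S ⊆ S' := Set.image_mono (Set.sdiff_subset_sdiff_left ball_subset_closedBall)
  have hSo : IsOpen S := by
    rw [isOpen_iff_mem_nhds]
    rintro _ ⟨z, hz, rfl⟩
    have hzU := hsub ⟨ball_subset_closedBall hz.1, hz.2⟩
    have hnhds := hUo.mem_nhds hzU
    rcases (hF.analyticAt hnhds).eventually_constant_or_nhds_le_map_nhds with h | h
    · exfalso
      have h1 : ∀ᶠ w in 𝓝 z, w = z := by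
        filter_upwards [h, hnhds] with w hw hwU using hinj hwU hzU hw
      have h2 : ∀ᶠ w in 𝓝[≠] z, w ∈ (∅ : Set ℂ) := by
        filter_upwards [h1.filter_mono nhdsWithin_le_nhds, self_mem_nhdsWithin] with w hw hw'
          using hw' hw
      simpa using h2.exists
    · refine h (Filter.image_mem_map ?_)
      exact (isOpen_ball.sdiff isClosed_singleton).mem_nhds hz
  have hS'c : IsOpen S'ᶜ := by
    rw [isOpen_iff_mem_nhds]
    intro w hw
    have h1 : ∀ᶠ z in 𝓝[≠] (0 : ℂ), ‖w‖ + 1 < ‖F z‖ :=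
      (tendsto_norm_cobounded_atTop.comp hlim).eventually_gt_atTop _
    obtain ⟨δ, hδ, hδF⟩ := Metric.mem_nhdsWithin_iff.1 h1
    have hcpt : IsCompact (F '' (closedBall 0 ρ \ ball 0 δ)) := by
      refine ((isCompact_closedBall (0 : ℂ) ρ).diff isOpen_ball).image_of_continuousOn ?_
      refine hF.continuousOn.mono fun z hz => hsub ⟨hz.1, fun h0 => hz.2 ?_⟩
      rw [Set.mem_singleton_iff.1 h0]
      exact mem_ball_self hδ
    have hw' : w ∉ F '' (closedBall 0 ρ \ ball 0 δ) := by
      rintro ⟨z, hz, rfl⟩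
      refine hw ⟨z, ⟨hz.1, fun h0 => hz.2 ?_⟩, rfl⟩
      rw [Set.mem_singleton_iff.1 h0]
      exact mem_ball_self hδ
    filter_upwards [hcpt.isClosed.isOpen_compl.mem_nhds hw', ball_mem_nhds w one_pos] with v hv hvb
    rintro ⟨z, hz, rfl⟩
    by_cases hzδ : z ∈ ball (0 : ℂ) δ
    · have h3 : ‖w‖ + 1 < ‖F z‖ := hδF ⟨hzδ, hz.2⟩
      have h4 : ‖F z - w‖ < 1 := by simpa [dist_eq_norm] using hvb
      have := norm_sub_norm_le (F z) w
      linarith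
    · exact hv ⟨z, ⟨hz.1, hzδ⟩, rfl⟩
  have hcover : Kᶜ ⊆ S ∪ S'ᶜ := by
    intro w hw
    by_cases hwS : w ∈ S'
    · left
      obtain ⟨z, hz, rfl⟩ := hwS
      refine ⟨z, ⟨?_, hz.2⟩, rfl⟩
      rcases (mem_closedBall.1 hz.1).lt_or_eq with h | h
      · exact h
      · exact absurd (hsph h) hw
    · exact Or.inr hwS
  have hne : (Kᶜ ∩ S).Nonempty := by
    have h1 : ∀ᶠ z in 𝓝[≠] (0 : ℂ), F z ∈ Kᶜ := hlim (Bornology.isBounded_def.1 hK)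
    have h2 : ∀ᶠ z in 𝓝[≠] (0 : ℂ), z ∈ ball (0 : ℂ) ρ :=
      nhdsWithin_le_nhds (ball_mem_nhds _ hρ)
    have h3 : ∀ᶠ z in 𝓝[≠] (0 : ℂ), z ≠ 0 := self_mem_nhdsWithin
    obtain ⟨z, h1, h2, h3⟩ := (h1.and (h2.and h3)).exists
    exact ⟨F z, h1, z, ⟨h2, h3⟩, rfl⟩
  have hall : Kᶜ ⊆ S := hKc.subset_left_of_subset_union hSo hS'c
    (Set.disjoint_compl_right_iff_subset.2 hSS') hcover hne
  intro z hz
  by_contra hzK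
  obtain ⟨w, hw, hwz⟩ := hall hzK
  have hz0 : z ∈ ball (0 : ℂ) 1 \ {0} := by
    refine ⟨hz.1, fun h0 => hz.2 ?_⟩
    rw [Set.mem_singleton_iff.1 h0]
    exact mem_closedBall_self hρ.le
  have := hinj (hsub ⟨ball_subset_closedBall hw.1, hw.2⟩) hz0 hwz
  rw [this] at hw
  exact hz.2 (ball_subset_closedBall hw.1)

/-! ### Ellipses -/

/-- The real-linear map `u ↦ α * conj u + b * u`. It maps circles centred at `0` to ellipses. -/
noncomputable def ellipseMap (α : ℝ) (b : ℂ) : ℂ →ₗ[ℝ] ℂ :=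
  α • Complex.conjAe.toLinearMap + LinearMap.mulLeft ℝ b

theorem ellipseMap_apply (α : ℝ) (b u : ℂ) :
    ellipseMap α b u = α * (starRingEnd ℂ) u + b * u := by
  simp [ellipseMap]

theorem det_ellipseMap (α : ℝ) (b : ℂ) : LinearMap.det (ellipseMap α b) = ‖b‖ ^ 2 - α ^ 2 := by
  rw [← LinearMap.det_toMatrix Complex.basisOneI, Matrix.det_fin_two, Complex.sq_norm,
    Complex.normSq_apply]
  simp [LinearMap.toMatrix_apply, ellipseMap_apply]
  ring

theorem le_norm_ellipseMap {α : ℝ} (hα : 0 ≤ α) (b u : ℂ) :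
    (α - ‖b‖) * ‖u‖ ≤ ‖ellipseMap α b u‖ := by
  rw [ellipseMap_apply]
  have h := norm_sub_le_norm_add ((α : ℂ) * (starRingEnd ℂ) u) (b * u)
  rw [norm_mul, norm_mul, RCLike.norm_conj, Complex.norm_real, Real.norm_of_nonneg hα] at h
  linarith

theorem bijective_ellipseMap {α : ℝ} {b : ℂ} (h : ‖b‖ < α) :
    Function.Bijective (ellipseMap α b) := by
  have hinj : Function.Injective (ellipseMap α b) := by
    rw [injective_iff_map_eq_zero]
    intro u hu
    have h1 := le_norm_ellipseMap ((norm_nonneg b).trans h.le) b u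
    rw [hu, norm_zero] at h1
    by_contra hu0
    have := mul_pos (sub_pos.2 h) (norm_pos_iff.2 hu0)
    linarith
  exact ⟨hinj, LinearMap.injective_iff_surjective.1 hinj⟩

/-! ### The area of the image of an annulus -/

/-- Integration over an annulus in polar coordinates. -/
theorem lintegral_annulus {g : ℂ → ENNReal} (hg : Measurable g) {ρ R : ℝ} (hρ : 0 ≤ ρ) :
    ∫⁻ z in ball 0 R \ closedBall 0 ρ, g z = ∫⁻ s in Set.Ioo ρ R,
      ENNReal.ofReal s * ∫⁻ θ in Set.Ioo (-Real.pi) Real.pi, g (circleMap 0 s θ) := by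
  have hA : MeasurableSet (ball (0 : ℂ) R \ closedBall 0 ρ) :=
    measurableSet_ball.diff measurableSet_closedBall
  have hpol : ∀ p : ℝ × ℝ, Complex.polarCoord.symm p = circleMap 0 p.1 p.2 := by
    intro p
    rw [Complex.polarCoord_symm_apply, circleMap_zero, Complex.exp_mul_I]
    push_cast
    rfl
  rw [← lintegral_indicator hA, ← Complex.lintegral_comp_polarCoord_symm, polarCoord_target,
    Measure.volume_eq_prod]
  simp only [hpol, smul_eq_mul]
  rw [setLIntegral_prod]
  · have hsub : Set.Ioo ρ R ⊆ Set.Ioi 0 := fun s hs => hρ.trans_lt hs.1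
    have h0 : ∀ s : ℝ, s ∈ Set.Ioi (0 : ℝ) →
        ∫⁻ θ in Set.Ioo (-Real.pi) Real.pi, ENNReal.ofReal s *
          (ball 0 R \ closedBall 0 ρ).indicator g (circleMap 0 s θ) =
        (Set.Ioo ρ R).indicator (fun s => ENNReal.ofReal s *
          ∫⁻ θ in Set.Ioo (-Real.pi) Real.pi, g (circleMap 0 s θ)) s := by
      intro s hs
      have hs' : |s| = s := abs_of_pos hs
      by_cases h : s ∈ Set.Ioo ρ R
      · rw [Set.indicator_of_mem h, ← lintegral_const_mul' _ _ ENNReal.ofReal_ne_top]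
        refine lintegral_congr fun θ => ?_
        rw [Set.indicator_of_mem]
        simpa [hs', and_comm] using h
      · rw [Set.indicator_of_notMem h]
        have : ∀ θ, (ball 0 R \ closedBall 0 ρ).indicator g (circleMap 0 s θ) = 0 := by
          intro θ
          rw [Set.indicator_of_notMem]
          intro h'
          exact h (by simpa [hs', and_comm] using h')
        simp [this]
    rw [setLIntegral_congr_fun measurableSet_Ioi h0, setLIntegral_indicator measurableSet_Ioo,
      Set.inter_eq_left.2 hsub]
  · refine Measurable.aemeasurable ?_
    refine (ENNReal.measurable_ofReal.comp measurable_fst).mul ?_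
    refine (hg.indicator hA).comp ?_
    have : Continuous fun p : ℝ × ℝ => circleMap 0 p.1 p.2 := by
      unfold circleMap
      fun_prop
    exact this.measurable

/-- The area of the image of a set under an injective holomorphic map. -/
theorem lintegral_sq_norm_deriv_eq_volume_image {F : ℂ → ℂ} {A : Set ℂ} (hA : MeasurableSet A)
    (hF : ∀ z ∈ A, DifferentiableAt ℂ F z) (hinj : Set.InjOn F A) :
    ∫⁻ z in A, ENNReal.ofReal (‖deriv F z‖ ^ 2) = volume (F '' A) := by
  rw [← lintegral_abs_det_fderiv_eq_addHaar_image volume hA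
    (fun z hz => ((hF z hz).hasDerivAt.hasFDerivAt.restrictScalars ℝ).hasFDerivWithinAt) hinj]
  refine lintegral_congr fun z => ?_
  congr 1
  rw [ContinuousLinearMap.det, ContinuousLinearMap.coe_restrictScalars,
    LinearMap.det_restrictScalars, Algebra.norm_complex_apply, Complex.normSq_eq_norm_sq,
    abs_of_nonneg (sq_nonneg _)]
  simp

/-- Lower bound for the area of the image of the annulus `ρ < ‖z‖ < 1` under a univalent function
`G z / z` with a simple pole, in terms of finitely many of its Laurent coefficients. -/
theorem le_volume_image_annulus {a : ℕ → ℂ} {G : ℂ → ℂ} (hG : DifferentiableOn ℂ G (ball 0 1))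
    (ha : ∀ z ∈ ball (0 : ℂ) 1, HasSum (fun n => a n * z ^ n) (G z))
    (hinj : Set.InjOn (fun z => G z / z) (ball 0 1 \ {0})) {ρ : ℝ} (hρ : 0 < ρ) (hρ1 : ρ < 1)
    (N : ℕ) :
    ENNReal.ofReal (Real.pi * ∑ n ∈ Finset.range N,
        ((n : ℝ) - 1) * ‖a n‖ ^ 2 * (1 - ρ ^ (2 * ((n : ℤ) - 1))))
      ≤ volume ((fun z => G z / z) '' (ball 0 1 \ closedBall 0 ρ)) := by
  set F : ℂ → ℂ := fun z => G z / z with hF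
  have hsub : ball (0 : ℂ) 1 \ closedBall 0 ρ ⊆ ball 0 1 \ {0} := by
    refine Set.sdiff_subset_sdiff_right ?_
    simpa using hρ.le
  have hderiv : ∀ z ∈ ball (0 : ℂ) 1 \ {0},
      HasDerivAt F ((z * deriv G z - G z) / z ^ 2) z := by
    intro z hz
    have h0 : z ≠ 0 := hz.2
    have := ((hG.differentiableAt (isOpen_ball.mem_nhds hz.1)).hasDerivAt).div
      (hasDerivAt_id z) h0
    refine this.congr_deriv ?_
    simp [mul_comm]
  have hA : MeasurableSet (ball (0 : ℂ) 1 \ closedBall 0 ρ) :=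
    measurableSet_ball.diff measurableSet_closedBall
  rw [← lintegral_sq_norm_deriv_eq_volume_image hA
    (fun z hz => (hderiv z (hsub hz)).differentiableAt) (hinj.mono hsub),
    lintegral_annulus (by fun_prop) hρ.le]
  have hcirc : ∀ s ∈ Set.Ioo ρ 1, ∀ θ, circleMap 0 s θ ∈ ball (0 : ℂ) 1 \ {0} := by
    intro s hs θ
    have hs0 : 0 < s := hρ.trans hs.1
    refine ⟨?_, ?_⟩
    · simpa [abs_of_pos hs0] using hs.2
    · simpa using hs0.ne'
  -- the integrand in the radial direction, bounded below by Bessel's inequality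
  have hinner : ∀ s ∈ Set.Ioo ρ 1,
      ENNReal.ofReal (2 * Real.pi * ∑ n ∈ Finset.range N,
        ((n : ℝ) - 1) ^ 2 * ‖a n‖ ^ 2 * s ^ (2 * ((n : ℤ) - 1) - 1)) ≤
      ENNReal.ofReal s * ∫⁻ θ in Set.Ioo (-Real.pi) Real.pi,
        ENNReal.ofReal (‖deriv F (circleMap 0 s θ)‖ ^ 2) := by
    intro s hs
    have hs0 : 0 < s := hρ.trans hs.1
    have hcont : Continuous fun θ => ‖deriv F (circleMap 0 s θ)‖ ^ 2 := by
      have h1 : DifferentiableOn ℂ F (ball 0 1 \ {0}) := fun z hz =>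
        (hderiv z hz).differentiableAt.differentiableWithinAt
      have h2 : ContinuousOn (deriv F) (ball 0 1 \ {0}) :=
        (h1.deriv (isOpen_ball.sdiff isClosed_singleton)).continuousOn
      exact ((h2.comp_continuous (continuous_circleMap 0 s) (hcirc s hs)).norm).pow 2
    have hbessel := sum_sq_norm_le_circleAverage (s := s)
      (c := fun n => ((n : ℂ) - 1) * a n / s ^ 2)
      (f := fun z => (z * deriv G z - G z) / s ^ 2) (fun z hz => by
        have hz' : z ∈ ball (0 : ℂ) 1 := by
          rw [mem_ball_zero_iff, hz, abs_of_pos hs0]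
          exact hs.2
        convert! (hasSum_mul_deriv_sub hG ha hz').div_const ((s : ℂ) ^ 2) using 2 with n
        ring) N
    have hper : ∫ θ in (-Real.pi)..Real.pi, ‖deriv F (circleMap 0 s θ)‖ ^ 2
        = 2 * Real.pi * Real.circleAverage
          (fun z => ‖(z * deriv G z - G z) / (s : ℂ) ^ 2‖ ^ 2) 0 s := by
      have hp : Function.Periodic (fun θ => ‖deriv F (circleMap 0 s θ)‖ ^ 2) (2 * Real.pi) :=
        fun θ => by simp only [periodic_circleMap 0 s θ]
      have h1 := hp.intervalIntegral_add_eq (-Real.pi) 0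
      rw [show -Real.pi + 2 * Real.pi = Real.pi by ring, zero_add] at h1
      rw [h1, Real.circleAverage, smul_eq_mul, mul_inv_cancel_left₀ (by positivity)]
      refine intervalIntegral.integral_congr fun θ _ => ?_
      simp only [(hderiv _ (hcirc s hs θ)).deriv, norm_div, norm_pow, norm_circleMap_zero,
        Complex.norm_real, Real.norm_eq_abs]
    rw [setLIntegral_congr Ioo_ae_eq_Ioc, ← ofReal_integral_eq_lintegral_ofReal,
      ← intervalIntegral.integral_of_le (by linarith [Real.pi_pos]), hper,
      ← ENNReal.ofReal_mul hs0.le]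
    · refine ENNReal.ofReal_le_ofReal ?_
      refine le_trans (le_of_eq ?_)
        (mul_le_mul_of_nonneg_left (mul_le_mul_of_nonneg_left hbessel
          (by positivity : 0 ≤ 2 * Real.pi)) hs0.le)
      rw [mul_left_comm s]
      congr 1
      rw [Finset.mul_sum]
      refine Finset.sum_congr rfl fun (n : ℕ) _ => ?_
      have e1 : ‖((n : ℂ) - 1)‖ ^ 2 = ((n : ℝ) - 1) ^ 2 := by
        rw [show ((n : ℂ) - 1) = (((n : ℝ) - 1 : ℝ) : ℂ) by push_cast; rfl, Complex.norm_real,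
          Real.norm_eq_abs, sq_abs]
      rw [norm_div, norm_mul, div_pow, mul_pow, e1, norm_pow, Complex.norm_real, Real.norm_eq_abs,
        abs_of_pos hs0, show 2 * ((n : ℤ) - 1) - 1 = ((2 * n : ℕ) : ℤ) - 3 by push_cast; ring,
        zpow_sub₀ hs0.ne', zpow_natCast]
      norm_cast
      field_simp
    · exact (hcont.integrableOn_Icc).mono_set Set.Ioc_subset_Icc_self
    · exact Eventually.of_forall fun θ => sq_nonneg _
  refine le_trans ?_ (setLIntegral_mono_ae' measurableSet_Ioo (Eventually.of_forall hinner))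
  -- the radial integral
  have hpos : ∀ s ∈ Set.uIcc ρ 1, s ≠ 0 := by
    intro s hs
    rw [Set.uIcc_of_le hρ1.le] at hs
    exact (hρ.trans_le hs.1).ne'
  have hcontOn : ContinuousOn (fun s : ℝ => 2 * Real.pi * ∑ n ∈ Finset.range N,
      ((n : ℝ) - 1) ^ 2 * ‖a n‖ ^ 2 * s ^ (2 * ((n : ℤ) - 1) - 1)) (Set.uIcc ρ 1) := by
    refine continuousOn_const.mul (continuousOn_finsetSum _ fun n _ => continuousOn_const.mul ?_)
    exact continuousOn_id.zpow₀ _ fun s hs => Or.inl (hpos s hs)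
  have hFTC := intervalIntegral.integral_eq_sub_of_hasDerivAt (a := ρ) (b := 1)
    (f := fun s : ℝ => Real.pi * ∑ n ∈ Finset.range N,
      ((n : ℝ) - 1) * ‖a n‖ ^ 2 * s ^ (2 * ((n : ℤ) - 1)))
    (f' := fun s : ℝ => 2 * Real.pi * ∑ n ∈ Finset.range N,
      ((n : ℝ) - 1) ^ 2 * ‖a n‖ ^ 2 * s ^ (2 * ((n : ℤ) - 1) - 1)) (fun s hs => by
      refine ((HasDerivAt.fun_sum fun (n : ℕ) _ =>
        ((hasDerivAt_zpow (2 * ((n : ℤ) - 1)) s (Or.inl (hpos s hs))).const_mul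
          (((n : ℝ) - 1) * ‖a n‖ ^ 2))).const_mul Real.pi).congr_deriv ?_
      rw [mul_comm 2 Real.pi, mul_assoc]
      congr 1
      rw [Finset.mul_sum]
      refine Finset.sum_congr rfl fun n _ => ?_
      push_cast
      ring)
    hcontOn.intervalIntegrable
  rw [← ofReal_integral_eq_lintegral_ofReal, setIntegral_congr_set Ioo_ae_eq_Ioc,
    ← intervalIntegral.integral_of_le hρ1.le, hFTC, ← mul_sub, ← Finset.sum_sub_distrib]
  · refine ENNReal.ofReal_le_ofReal (le_of_eq ?_)
    congr 1
    refine Finset.sum_congr rfl fun n _ => ?_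
    rw [one_zpow]
    ring
  · exact ((hcontOn.integrableOn_compact isCompact_uIcc).mono_set (by
      rw [Set.uIcc_of_le hρ1.le]; exact Set.Ioo_subset_Icc_self))
  · refine (ae_restrict_iff' measurableSet_Ioo).2 (Eventually.of_forall fun s hs => ?_)
    have hs0 : 0 < s := hρ.trans hs.1
    show 0 ≤ _
    positivity

/-! ### The area theorem -/

/-- Second order expansion at `0` from a power series. -/
theorem exists_norm_sub_le_of_hasSum {a : ℕ → ℂ} {G : ℂ → ℂ}
    (ha : ∀ z ∈ ball (0 : ℂ) 1, HasSum (fun n => a n * z ^ n) (G z)) :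
    ∃ C, 0 < C ∧ ∀ᶠ z in 𝓝 (0 : ℂ), ‖G z - (a 0 + a 1 * z + a 2 * z ^ 2)‖ ≤ C * ‖z‖ ^ 3 := by
  have hp : HasFPowerSeriesAt G (FormalMultilinearSeries.ofScalars ℂ a) 0 := by
    rw [hasFPowerSeriesAt_iff]
    filter_upwards [ball_mem_nhds (0 : ℂ) one_pos] with z hz
    simpa [mul_comm] using ha z hz
  obtain ⟨C, hC, h⟩ := (hp.isBigO_sub_partialSum_pow 3).exists_pos
  refine ⟨C, hC, ?_⟩
  filter_upwards [h.bound] with z hz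
  simpa [FormalMultilinearSeries.partialSum, Finset.sum_range_succ,
    FormalMultilinearSeries.ofScalars_apply_eq, mul_comm] using hz

/-- For small `ρ` the function `G z / z = 1 / z + a 1 + a 2 * z + ⋯` maps the annulus `ρ < ‖z‖ < 1`
into a solid ellipse: the one bounded by the image of the circle of radius `ρ` under the first three
terms, dilated from its centre by the factor `1 + C * ρ ^ 3`. -/
theorem eventually_mapsTo_ellipse {a : ℕ → ℂ} {G : ℂ → ℂ}
    (hG : DifferentiableOn ℂ G (ball 0 1)) (ha0 : a 0 = 1)
    (ha : ∀ z ∈ ball (0 : ℂ) 1, HasSum (fun n => a n * z ^ n) (G z))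
    (hinj : Set.InjOn (fun z => G z / z) (ball 0 1 \ {0})) :
    ∃ C, 0 < C ∧ ∀ᶠ ρ in 𝓝[>] (0 : ℝ), ‖a 2‖ < (ρ ^ 2)⁻¹ ∧
      Set.MapsTo (fun z => G z / z) (ball 0 1 \ closedBall 0 ρ)
        ((fun u => a 1 + ellipseMap (ρ ^ 2)⁻¹ (a 2) u) '' closedBall 0 (ρ * (1 + C * ρ ^ 3))) := by
  obtain ⟨C, hC, hexp⟩ := exists_norm_sub_le_of_hasSum ha
  have hG0 : G 0 = 1 := by
    have h := ha 0 (mem_ball_self one_pos)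
    have h' := hasSum_single (f := fun n => a n * (0 : ℂ) ^ n) 0 (fun n hn => by simp [hn])
    rw [h.unique h']
    simp [ha0]
  have hlim : Tendsto (fun z => G z / z) (𝓝[≠] 0) (Bornology.cobounded ℂ) := by
    rw [← tendsto_norm_atTop_iff_cobounded]
    have h1 : Tendsto (fun z => ‖G z‖) (𝓝[≠] 0) (𝓝 1) := by
      have hc : ContinuousAt G 0 :=
        (hG.differentiableAt (ball_mem_nhds 0 one_pos)).continuousAt
      have := hc.tendsto.norm
      rw [hG0, norm_one] at this
      exact this.mono_left nhdsWithin_le_nhds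
    have h2 : Tendsto (fun z : ℂ => ‖z⁻¹‖) (𝓝[≠] 0) atTop :=
      tendsto_norm_cobounded_atTop.comp Filter.tendsto_inv₀_nhdsNE_zero
    refine (h1.pos_mul_atTop one_pos h2).congr fun z => ?_
    rw [div_eq_mul_inv, norm_mul]
  have hFd : DifferentiableOn ℂ (fun z => G z / z) (ball 0 1 \ {0}) :=
    (hG.mono Set.sdiff_subset).div differentiableOn_id fun z hz => hz.2
  obtain ⟨δ, hδ, hexp⟩ := Metric.eventually_nhds_iff.1 hexp
  refine ⟨2 * C, by positivity, ?_⟩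
  have hsmall : ∀ᶠ ρ in 𝓝[>] (0 : ℝ), 2 * ‖a 2‖ < (ρ ^ 2)⁻¹ := by
    have h : Tendsto (fun ρ : ℝ => ρ ^ 2) (𝓝[>] 0) (𝓝[>] 0) := by
      refine tendsto_nhdsWithin_iff.2 ⟨?_, ?_⟩
      · have : Tendsto (fun ρ : ℝ => ρ ^ 2) (𝓝 0) (𝓝 (0 ^ 2)) :=
          (continuous_pow 2).tendsto 0
        rw [zero_pow two_ne_zero] at this
        exact this.mono_left nhdsWithin_le_nhds
      · filter_upwards [self_mem_nhdsWithin] with ρ hρ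
        exact Set.mem_Ioi.2 (pow_pos (Set.mem_Ioi.1 hρ) 2)
    exact (tendsto_inv_nhdsGT_zero.comp h).eventually_gt_atTop _
  have hlt : ∀ᶠ ρ in 𝓝[>] (0 : ℝ), ρ < min δ 1 :=
    nhdsWithin_le_nhds (Iio_mem_nhds (by positivity))
  filter_upwards [hsmall, hlt, self_mem_nhdsWithin] with ρ hρs hρlt hρ
  have hρ : 0 < ρ := hρ
  have hρδ : ρ < δ := hρlt.trans_le (min_le_left _ _)
  have hρ1 : ρ < 1 := hρlt.trans_le (min_le_right _ _)
  have hlta : ‖a 2‖ < (ρ ^ 2)⁻¹ := by linarith [norm_nonneg (a 2)]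
  refine ⟨hlta, ?_⟩
  set T := ellipseMap (ρ ^ 2)⁻¹ (a 2) with hT
  have hTb : Function.Bijective T := bijective_ellipseMap hlta
  have hTc : Continuous T := T.continuous_of_finiteDimensional
  have hTac : Continuous fun u => a 1 + T u := continuous_const.add hTc
  have hTab : Function.Bijective fun u => a 1 + T u :=
    (Equiv.addLeft (a 1)).bijective.comp hTb
  have hR : 0 ≤ ρ * (1 + 2 * C * ρ ^ 3) := by positivity
  refine mapsTo_of_mapsTo_sphere hρ hρ1 hFd hinj hlim
    ((isCompact_closedBall _ _).image hTac).isBounded ?_ ?_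
  · rw [← Set.image_compl_eq hTab]
    have : (closedBall (0 : ℂ) (ρ * (1 + 2 * C * ρ ^ 3)))ᶜ =
        {u : ℂ | ρ * (1 + 2 * C * ρ ^ 3) < ‖u‖} := by
      ext u
      simp
    rw [this]
    exact (isPreconnected_setOf_lt_norm hR).image _ hTac.continuousOn
  · intro z hz
    have hzρ : ‖z‖ = ρ := by simpa using hz
    have hz0 : z ≠ 0 := by
      rw [← norm_pos_iff, hzρ]
      exact hρ
    obtain ⟨v, hv⟩ := hTb.surjective (G z / z - a 1)
    refine ⟨v, ?_, by simp [hv]⟩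
    -- on the circle of radius `ρ` one has `z⁻¹ = conj z / ρ ^ 2`
    have hTz : T z = z⁻¹ + a 2 * z := by
      rw [hT, ellipseMap_apply, Complex.inv_def, Complex.normSq_eq_norm_sq, hzρ]
      push_cast
      ring
    have h1 : ‖T (v - z)‖ ≤ C * ρ ^ 2 := by
      have e : T (v - z) = (G z - (a 0 + a 1 * z + a 2 * z ^ 2)) / z := by
        rw [map_sub, hv, hTz, ha0]
        field_simp
        ring
      rw [e, norm_div, hzρ, div_le_iff₀ hρ]
      refine (hexp (y := z) (by simpa [hzρ] using hρδ)).trans (le_of_eq ?_)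
      rw [hzρ]
      ring
    have h2 := (le_norm_ellipseMap (by positivity : 0 ≤ (ρ ^ 2)⁻¹) (a 2) (v - z)).trans h1
    have h3 : (ρ ^ 2)⁻¹ / 2 * ‖v - z‖ ≤ C * ρ ^ 2 :=
      (mul_le_mul_of_nonneg_right (by linarith) (norm_nonneg _)).trans h2
    have h4 : ‖v - z‖ ≤ 2 * C * ρ ^ 4 := by
      have e : ‖v - z‖ = 2 * ρ ^ 2 * ((ρ ^ 2)⁻¹ / 2 * ‖v - z‖) := by
        field_simp
      rw [e]
      calc 2 * ρ ^ 2 * ((ρ ^ 2)⁻¹ / 2 * ‖v - z‖) ≤ 2 * ρ ^ 2 * (C * ρ ^ 2) := by gcongr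
        _ = 2 * C * ρ ^ 4 := by ring
    rw [mem_closedBall_zero_iff]
    calc ‖v‖ = ‖z + (v - z)‖ := by ring_nf
      _ ≤ ‖z‖ + ‖v - z‖ := norm_add_le _ _
      _ ≤ ρ + 2 * C * ρ ^ 4 := by rw [hzρ]; gcongr
      _ = ρ * (1 + 2 * C * ρ ^ 3) := by ring

/-- The area of an ellipse with semi-axes `α * R ± ‖b‖ * R` is at most `π * α ^ 2 * R ^ 2`. -/
theorem volume_ellipse_le {α R : ℝ} {b c : ℂ} (hb : ‖b‖ ≤ α) (hR : 0 ≤ R) :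
    volume ((fun u => c + ellipseMap α b u) '' closedBall 0 R)
      ≤ ENNReal.ofReal (Real.pi * (α ^ 2 * R ^ 2)) := by
  have h : (fun u => c + ellipseMap α b u) '' closedBall 0 R
      = (fun w => c + w) '' (ellipseMap α b '' closedBall 0 R) := by
    rw [Set.image_image]
  rw [h, Set.image_add_left, measure_preimage_add, Measure.addHaar_image_linearMap,
    det_ellipseMap, Complex.volume_closedBall, ← ENNReal.ofReal_pow hR,
    show ((NNReal.pi : NNReal) : ENNReal) = ENNReal.ofReal Real.pi by
      rw [← NNReal.coe_real_pi, ENNReal.ofReal_coe_nnreal],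
    ← ENNReal.ofReal_mul (by positivity), ← ENNReal.ofReal_mul (by positivity)]
  refine ENNReal.ofReal_le_ofReal ?_
  have h1 : |‖b‖ ^ 2 - α ^ 2| ≤ α ^ 2 := by
    have : ‖b‖ ^ 2 ≤ α ^ 2 := by gcongr
    rw [abs_of_nonpos (by linarith)]
    linarith [sq_nonneg ‖b‖]
  calc |‖b‖ ^ 2 - α ^ 2| * (R ^ 2 * Real.pi) ≤ α ^ 2 * (R ^ 2 * Real.pi) := by gcongr
    _ = Real.pi * (α ^ 2 * R ^ 2) := by ring

/-- **Gronwall's area theorem**. If `G z / z = 1 / z + a 1 + a 2 * z + ⋯` is univalent in the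
punctured unit disc, then `∑ n * ‖a (n + 1)‖ ^ 2 ≤ 1`. -/
theorem area_theorem {a : ℕ → ℂ} {G : ℂ → ℂ} (hG : DifferentiableOn ℂ G (ball 0 1))
    (ha0 : a 0 = 1) (ha : ∀ z ∈ ball (0 : ℂ) 1, HasSum (fun n => a n * z ^ n) (G z))
    (hinj : Set.InjOn (fun z => G z / z) (ball 0 1 \ {0})) (N : ℕ) :
    ∑ n ∈ Finset.range N, (n : ℝ) * ‖a (n + 1)‖ ^ 2 ≤ 1 := by
  obtain ⟨C, hC, hmaps⟩ := eventually_mapsTo_ellipse hG ha0 ha hinj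
  have hineq : ∀ᶠ ρ in 𝓝[>] (0 : ℝ),
      ∑ n ∈ Finset.range N, (n : ℝ) * ‖a (n + 1)‖ ^ 2 * (1 - ρ ^ (2 * n))
        ≤ 1 + 2 * C * ρ + C ^ 2 * ρ ^ 4 := by
    have hlt : ∀ᶠ ρ in 𝓝[>] (0 : ℝ), ρ < 1 := nhdsWithin_le_nhds (Iio_mem_nhds one_pos)
    filter_upwards [hmaps, hlt, self_mem_nhdsWithin] with ρ ⟨hρa, hρm⟩ hρ1 hρ
    have hρ : 0 < ρ := hρ
    have h := (le_volume_image_annulus hG ha hinj hρ hρ1 (N + 1)).trans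
      ((measure_mono hρm.image_subset).trans
        (volume_ellipse_le hρa.le (by positivity)))
    rw [ENNReal.ofReal_le_ofReal_iff (by positivity), mul_le_mul_iff_right₀ Real.pi_pos,
      Finset.sum_range_succ'] at h
    have e1 : ∀ n : ℕ, (((n + 1 : ℕ) : ℝ) - 1) * ‖a (n + 1)‖ ^ 2 *
        (1 - ρ ^ (2 * (((n + 1 : ℕ) : ℤ) - 1))) = (n : ℝ) * ‖a (n + 1)‖ ^ 2 * (1 - ρ ^ (2 * n)) := by
      intro n
      rw [show 2 * (((n + 1 : ℕ) : ℤ) - 1) = ((2 * n : ℕ) : ℤ) by push_cast; ring, zpow_natCast]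
      push_cast
      ring
    rw [Finset.sum_congr rfl fun n _ => e1 n, ha0,
      show 2 * (((0 : ℕ) : ℤ) - 1) = -((2 : ℕ) : ℤ) by norm_num, zpow_neg, zpow_natCast] at h
    have e2 : ((ρ ^ 2)⁻¹) ^ 2 * (ρ * (1 + C * ρ ^ 3)) ^ 2
        = (ρ ^ 2)⁻¹ + 2 * C * ρ + C ^ 2 * ρ ^ 4 := by
      field_simp
      ring
    rw [e2] at h
    simp only [Nat.cast_zero, norm_one] at h
    linarith
  have hl : Tendsto (fun ρ : ℝ => ∑ n ∈ Finset.range N,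
      (n : ℝ) * ‖a (n + 1)‖ ^ 2 * (1 - ρ ^ (2 * n))) (𝓝[>] 0)
      (𝓝 (∑ n ∈ Finset.range N, (n : ℝ) * ‖a (n + 1)‖ ^ 2 * (1 - (0 : ℝ) ^ (2 * n)))) := by
    refine (Continuous.tendsto ?_ 0).mono_left nhdsWithin_le_nhds
    fun_prop
  have hr : Tendsto (fun ρ : ℝ => 1 + 2 * C * ρ + C ^ 2 * ρ ^ 4) (𝓝[>] 0)
      (𝓝 (1 + 2 * C * 0 + C ^ 2 * 0 ^ 4)) := by
    refine (Continuous.tendsto (f := fun ρ : ℝ => 1 + 2 * C * ρ + C ^ 2 * ρ ^ 4) ?_ 0).mono_left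
      nhdsWithin_le_nhds
    fun_prop
  have h := le_of_tendsto_of_tendsto hl hr hineq
  refine le_trans (le_of_eq (Finset.sum_congr rfl fun n _ => ?_)) (h.trans (le_of_eq (by ring)))
  rcases n with _ | n <;> simp

/-! ### The square root transform and its reciprocal -/

/-- The power series coefficients `e` of `exp (-l)` are determined by those of `l`, through the
differential equation `E' = -l' * E`. -/
theorem coeff_exp_neg_succ {l : ℂ → ℂ} {g e : ℕ → ℂ} (hl : DifferentiableOn ℂ l (ball 0 1))
    (hg : ∀ z ∈ ball (0 : ℂ) 1, HasSum (fun n => g n * z ^ n) (l z))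
    (he : ∀ z ∈ ball (0 : ℂ) 1, HasSum (fun n => e n * z ^ n) (Complex.exp (-l z))) (n : ℕ) :
    ((n : ℂ) + 1) * e (n + 1) =
      -∑ i ∈ Finset.range (n + 1), ((i : ℂ) + 1) * g (i + 1) * e (n - i) := by
  set E : ℂ → ℂ := fun z => Complex.exp (-l z) with hE
  have h0 : ball (0 : ℂ) 1 ∈ 𝓝 (0 : ℂ) := ball_mem_nhds 0 one_pos
  have hEd : DifferentiableOn ℂ E (ball 0 1) := hl.neg.cexp
  have hode : deriv E =ᶠ[𝓝 0] -(deriv l * E) := by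
    filter_upwards [h0] with z hz
    have h := ((hl.differentiableAt (isOpen_ball.mem_nhds hz)).hasDerivAt.neg.cexp).deriv
    simp only [Pi.neg_apply, Pi.mul_apply]
    refine h.trans ?_
    simp only [hE, Pi.neg_apply]
    ring
  have hl' : ContDiffAt ℂ n (deriv l) 0 := ((hl.deriv isOpen_ball).analyticAt h0).contDiffAt
  have hE' : ContDiffAt ℂ n E 0 := (hEd.analyticAt h0).contDiffAt
  have h := iteratedDeriv_zero_of_hasSum he (n + 1)
  rw [iteratedDeriv_succ', hode.iteratedDeriv_eq, iteratedDeriv_neg, iteratedDeriv_mul hl' hE',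
    Nat.factorial_succ] at h
  have hn : (n.factorial : ℂ) ≠ 0 := Nat.cast_ne_zero.2 n.factorial_ne_zero
  refine mul_left_cancel₀ hn ?_
  push_cast at h
  rw [← mul_assoc, mul_comm (n.factorial : ℂ), ← h, mul_neg, Finset.mul_sum]
  congr 1
  refine Finset.sum_congr rfl fun i hi => ?_
  have hin : i ≤ n := Nat.lt_succ_iff.1 (Finset.mem_range.1 hi)
  rw [← iteratedDeriv_succ', iteratedDeriv_zero_of_hasSum hg, iteratedDeriv_zero_of_hasSum he,
    ← Nat.choose_mul_factorial_mul_factorial hin, Nat.factorial_succ]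
  push_cast
  ring

/-- If `exp (L z) = f z / z` with `f` univalent, then `exp (-L (z ^ 2) / 2) / z`, which is the
reciprocal of the square root transform `√(f (z ^ 2))`, is univalent in the punctured disc. -/
theorem injOn_inv_sqrt_transform {f L : ℂ → ℂ} (hf : IsClassS f) (hL : IsLogBranch f L) :
    Set.InjOn (fun z => Complex.exp (-(L (z ^ 2) / 2)) / z) (ball 0 1 \ {0}) := by
  have hsq : ∀ z ∈ ball (0 : ℂ) 1 \ {0}, z ^ 2 ∈ ball (0 : ℂ) 1 ∧ z ^ 2 ≠ 0 := by
    intro z hz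
    refine ⟨?_, pow_ne_zero 2 hz.2⟩
    have := mem_ball_zero_iff.1 hz.1
    rw [mem_ball_zero_iff, norm_pow]
    exact pow_lt_one₀ (norm_nonneg z) this two_ne_zero
  have hval : ∀ z ∈ ball (0 : ℂ) 1 \ {0},
      (Complex.exp (-(L (z ^ 2) / 2)) / z) ^ 2 = (f (z ^ 2))⁻¹ := by
    intro z hz
    have h0 : z ≠ 0 := hz.2
    rw [div_pow, ← Complex.exp_nat_mul,
      show ((2 : ℕ) : ℂ) * -(L (z ^ 2) / 2) = -L (z ^ 2) by push_cast; ring, Complex.exp_neg,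
      hL.exp_eq _ (hsq z hz).1 (hsq z hz).2]
    field_simp
  intro z hz w hw h
  have h' : Complex.exp (-(L (z ^ 2) / 2)) / z = Complex.exp (-(L (w ^ 2) / 2)) / w := h
  have h2 := congrArg (· ^ 2) h'
  simp only [hval z hz, hval w hw] at h2
  have h3 := hf.injOn (hsq z hz).1 (hsq w hw).1 (inv_injective h2)
  rw [h3] at h'
  have hw0 : w ≠ 0 := hw.2
  have hz0 : z ≠ 0 := hz.2
  have := Complex.exp_ne_zero (-(L (w ^ 2) / 2))
  field_simp at h'
  exact h'.symm

/-- The area theorem for the reciprocal of the square root transform. -/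
theorem sum_sq_norm_coeff_exp_le_one {f L : ℂ → ℂ} (hf : IsClassS f) (hL : IsLogBranch f L)
    {e : ℕ → ℂ}
    (he : ∀ z ∈ ball (0 : ℂ) 1, HasSum (fun n => e n * z ^ n) (Complex.exp (-(L z / 2)))) :
    ‖e 1‖ ^ 2 + 3 * ‖e 2‖ ^ 2 + 5 * ‖e 3‖ ^ 2 + 7 * ‖e 4‖ ^ 2 ≤ 1 := by
  have hsq : ∀ z ∈ ball (0 : ℂ) 1, z ^ 2 ∈ ball (0 : ℂ) 1 := by
    intro z hz
    rw [mem_ball_zero_iff] at hz ⊢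
    rw [norm_pow]
    exact pow_lt_one₀ (norm_nonneg z) hz two_ne_zero
  have he0 : e 0 = 1 := by
    have h := iteratedDeriv_zero_of_hasSum he 0
    simpa [hL.map_zero] using h.symm
  have hG : DifferentiableOn ℂ (fun z => Complex.exp (-(L (z ^ 2) / 2))) (ball 0 1) := by
    have : DifferentiableOn ℂ (fun z => L (z ^ 2)) (ball 0 1) :=
      hL.differentiableOn.comp (by fun_prop) hsq
    exact (this.div_const 2).neg.cexp
  have ha : ∀ z ∈ ball (0 : ℂ) 1, HasSum (fun n => (if Even n then e (n / 2) else 0) * z ^ n)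
      (Complex.exp (-(L (z ^ 2) / 2))) := by
    intro z hz
    have hinj : Function.Injective fun n : ℕ => 2 * n := fun m n h => by
      simpa using h
    rw [← hinj.hasSum_iff]
    · convert! he (z ^ 2) (hsq z hz) using 2 with n
      simp [pow_mul]
    · intro n hn
      have : ¬ Even n := fun ⟨k, hk⟩ => hn ⟨k, by simp only; omega⟩
      simp [this]
  have h := area_theorem hG (by simp [he0]) ha (injOn_inv_sqrt_transform hf hL) 8
  have h3 : Odd 3 := by decide
  have h5 : Odd 5 := by decide
  have h7 : Odd 7 := by decide
  have h2 : ¬ Odd 2 := by decide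
  have h4 : ¬ Odd 4 := by decide
  have h6 : ¬ Odd 6 := by decide
  simp [Finset.sum_range_succ, Nat.even_add_one, h2, h3, h4, h5, h6, h7] at h
  linarith

/-! ### Real inequalities -/

/-- The form `√m * y ≤ 1 - q / 2` of the tangent bound `√(1 - q) ≤ 1 - q / 2`. -/
theorem sqrt_mul_le_one_sub {m q y : ℝ} (hm : 0 ≤ m) (hq : q ≤ 1) (h : q + m * y ^ 2 ≤ 1) :
    Real.sqrt m * y ≤ 1 - q / 2 := by
  refine (abs_le_of_sq_le_sq' ?_ (by linarith)).2
  rw [mul_pow, Real.sq_sqrt hm]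
  nlinarith [sq_nonneg q]

theorem add_cube_le_one_div_sqrt_five {x y : ℝ} (hx : 0 ≤ x) (h : x ^ 2 + 5 * y ^ 2 ≤ 1) :
    y + x ^ 3 / 6 ≤ 1 / Real.sqrt 5 := by
  have hx1 : x ≤ 1 := by nlinarith [sq_nonneg y]
  have h1 := sqrt_mul_le_one_sub (by norm_num) (by nlinarith [sq_nonneg y]) h
  have ht : Real.sqrt 5 ≤ 3 := Real.sqrt_le_iff.2 (by norm_num)
  rw [le_div_iff₀ (by positivity)]
  have h2 : x ^ 3 * Real.sqrt 5 ≤ x ^ 2 * 3 := by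
    gcongr ?_ * ?_
    exact pow_le_pow_of_le_one hx hx1 (by norm_num)
  linarith

theorem add_sq_add_pow_four_le_one_div_sqrt_seven {x y v : ℝ} (hx : 0 ≤ x)
    (h : x ^ 2 + 3 * y ^ 2 + 7 * v ^ 2 ≤ 1) :
    v + y ^ 2 / 2 + x ^ 4 / 12 ≤ 1 / Real.sqrt 7 := by
  have hx1 : x ≤ 1 := by nlinarith [sq_nonneg y, sq_nonneg v]
  have h1 := sqrt_mul_le_one_sub (by norm_num) (by nlinarith [sq_nonneg v]) h
  have ht : Real.sqrt 7 ≤ 3 := Real.sqrt_le_iff.2 (by norm_num)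
  rw [le_div_iff₀ (by positivity)]
  have h2 : x ^ 4 * Real.sqrt 7 ≤ x ^ 2 * 3 := by
    gcongr ?_ * ?_
    exact pow_le_pow_of_le_one hx hx1 (by norm_num)
  have h3 : y ^ 2 * Real.sqrt 7 ≤ y ^ 2 * 3 := by gcongr
  nlinarith [sq_nonneg x]

/-! ### Logarithmic coefficients -/

/-- For the logarithmic coefficients `γ n` of a function `f` of the class `S`,
`|γ₃| - |γ₂| ≤ 1 / √5` and `|γ₄| - |γ₃| ≤ 1 / √7`. -/
theorem theorem1 (f : ℂ → ℂ) (hf : IsClassS f) (γ : ℕ → ℂ) (hγ : IsLogCoeffs f γ) :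
    ‖γ 3‖ - ‖γ 2‖ ≤ 1 / Real.sqrt 5 ∧ ‖γ 4‖ - ‖γ 3‖ ≤ 1 / Real.sqrt 7 := by
  obtain ⟨L, hL, hsum⟩ := hγ
  have hl : DifferentiableOn ℂ (fun z => L z / 2) (ball 0 1) := hL.differentiableOn.div_const 2
  -- `γ 0` plays no role in the expansion, so it is replaced by the constant term `0`
  have hg : ∀ z ∈ ball (0 : ℂ) 1,
      HasSum (fun n => (if n = 0 then 0 else γ n) * z ^ n) (L z / 2) := by
    intro z hz
    rw [← hasSum_nat_add_iff' 1]
    convert! (hsum z hz).div_const 2 using 1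
    · ext n
      simp
    · simp
  obtain ⟨e, he⟩ : ∃ e : ℕ → ℂ, ∀ z ∈ ball (0 : ℂ) 1,
      HasSum (fun n => e n * z ^ n) (Complex.exp (-(L z / 2))) := by
    have hE : DifferentiableOn ℂ (fun z => Complex.exp (-(L z / 2))) (ball 0 1) := hl.neg.cexp
    refine ⟨fun n => (n.factorial : ℂ)⁻¹ *
      iteratedDeriv n (fun z => Complex.exp (-(L z / 2))) 0, fun z hz => ?_⟩
    convert! Complex.hasSum_taylorSeries_on_ball hE hz using 2 with n
    simp only [sub_zero, smul_eq_mul]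
    ring
  have he0 : e 0 = 1 := by
    have h := iteratedDeriv_zero_of_hasSum he 0
    simpa [hL.map_zero] using h.symm
  have harea := sum_sq_norm_coeff_exp_le_one hf hL he
  have e1 := coeff_exp_neg_succ hl hg he 0
  have e2 := coeff_exp_neg_succ hl hg he 1
  have e3 := coeff_exp_neg_succ hl hg he 2
  have e4 := coeff_exp_neg_succ hl hg he 3
  simp [Finset.sum_range_succ, he0] at e1 e2 e3 e4
  rw [e1] at e2 e3
  have e2' : e 2 = -γ 2 + γ 1 ^ 2 / 2 := by linear_combination e2 / 2
  have e3' : e 3 = -γ 3 + γ 1 * γ 2 - γ 1 ^ 3 / 6 := by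
    rw [e2'] at e3
    linear_combination e3 / 3
  have hnorm : ‖e 1‖ = ‖γ 1‖ := by rw [e1, norm_neg]
  have hγ1 : ‖γ 1‖ ≤ 1 := by
    rw [hnorm] at harea
    nlinarith [sq_nonneg ‖γ 1‖, sq_nonneg ‖e 2‖, sq_nonneg ‖e 3‖, sq_nonneg ‖e 4‖]
  have hdiff : ∀ u v : ℂ, ‖u‖ - ‖v‖ ≤ ‖u - γ 1 * v‖ := by
    intro u v
    have h1 := norm_sub_norm_le u (γ 1 * v)
    rw [norm_mul] at h1
    have h2 := mul_le_of_le_one_left (norm_nonneg v) hγ1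
    linarith
  rw [hnorm] at harea
  constructor
  · have h3 : γ 3 - γ 1 * γ 2 = -(e 3 + γ 1 ^ 3 / 6) := by
      rw [e3']
      ring
    refine (hdiff _ _).trans ?_
    rw [h3, norm_neg]
    refine (norm_add_le _ _).trans ?_
    rw [norm_div, norm_pow, Complex.norm_ofNat]
    exact add_cube_le_one_div_sqrt_five (norm_nonneg _)
      (by nlinarith [sq_nonneg ‖e 2‖, sq_nonneg ‖e 4‖])
  · have h4 : γ 4 - γ 1 * γ 3 = -e 4 + e 2 ^ 2 / 2 + -(γ 1 ^ 4 / 12) := by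
      rw [e1, e2', e3'] at e4
      rw [e2']
      linear_combination e4 / 4
    refine (hdiff _ _).trans ?_
    rw [h4]
    refine (norm_add₃_le).trans ?_
    rw [norm_neg, norm_neg, norm_div, norm_div, norm_pow, norm_pow, Complex.norm_ofNat,
      Complex.norm_ofNat]
    exact add_sq_add_pow_four_le_one_div_sqrt_seven (norm_nonneg _)
      (by nlinarith [sq_nonneg ‖e 3‖])
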